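/- Let $(\Omega,\mathcal F)$ be a measurable space, $\mathbb F$ the space of bounded $\mathcal F$-measurable functions $\Omega\to\mathbb R$, $\mathcal C\subset\mathcal F$ a sub-$\sigma$-algebra, and $\mathbb C$ the set of bounded $\mathcal C$-measurable functions. Let $\rho:\mathbb F\to\mathbb R$ be a sublinear operator, that is, $\rho$ is monotone, $\rho(c)=c$ for constants $c\in\mathbb R$, $\rho(\xi_1+\xi_2)\le\rho(\xi_1)+\rho(\xi_2)$, and $\rho(\lambda\xi)=\lambda\rho(\xi)$ for $\lambda\ge 0$. Let $\mathcal P$ be the set of all linear functionals $E_P:\mathbb F\to\mathbb R$ with $E_P\le\rho$ on $\mathbb F$; write $P(A)=E_P[\mathbf 1_A]$ for $A\in\mathcal F$. Assume that $\rho$ is continuous from above, i.e. $\rho(\xi_n)\downarrow 0$ whenever $\xi_n\in\mathbb F$ and $\xi_n\downarrow 0$ pointwise, and proper, i.e. there is a probability measure $P_0$ on $\mathcal F$ such that every $P\in\mathcal P$ is equivalent to $P_0$ (has the same null sets). Fix such a $P_0$. Then for every $\xi\in\mathbb F$ there is $\hat\eta\in\mathbb C$ with $\rho\big((\xi-\hat\eta)^2\big)=\inf_{\eta\in\mathbb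 C}\rho\big((\xi-\eta)^2\big)$, and any two such $\hat\eta$ coincide $P_0$-a.s.; denote it by $\rho(\xi|\mathcal C)$ (the minimum mean square estimator). Moreover, the following hold $P_0$-almost surely. i) If $C_1\le\xi(\omega)\le C_2$ for all $\omega\in\Omega$, with constants $C_1,C_2\in\mathbb R$, then $C_1\le\rho(\xi|\mathcal C)\le C_2$. ii) $\rho(\lambda\xi|\mathcal C)=\lambda\,\rho(\xi|\mathcal C)$ for every $\lambda\in\mathbb R$. iii) $\rho(\xi+\eta_0|\mathcal C)=\rho(\xi|\mathcal C)+\eta_0$ for every $\eta_0\in\mathbb C$. iv) If $\xi$ is independent of $\mathcal C$ under every $P\in\mathcal P$, i.e. $P(A\cap B)=P(A)P(B)$ for all $A\in\sigma(\xi)$, $B\in\mathcal C$, then $\rho(\xi|\mathcal C)$ is a constant. -/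

import Mathlib

open MeasureTheory Filter Topology

noncomputable section

/-- `BddMeas Ω` is the algebra of all bounded measurable functions `Ω → ℝ` on the measurable
space `Ω`, with pointwise operations (the space written `𝔽`). -/
def BddMeas (Ω : Type*) [MeasurableSpace Ω] : Subalgebra ℝ (Ω → ℝ) where
  carrier := {f | Measurable f ∧ ∃ M : ℝ, ∀ ω, |f ω| ≤ M}
  mul_mem' := by
    rintro f g ⟨hf, M, hM⟩ ⟨hg, N, hN⟩
    refine ⟨hf.mul hg, M * N, fun ω => ?_⟩
    rw [Pi.mul_apply, abs_mul]
    exact mul_le_mul (hM ω) (hN ω) (abs_nonneg _) ((abs_nonneg _).trans (hM ω))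
  add_mem' := by
    rintro f g ⟨hf, M, hM⟩ ⟨hg, N, hN⟩
    exact ⟨hf.add hg, M + N, fun ω => (abs_add_le _ _).trans (add_le_add (hM ω) (hN ω))⟩
  algebraMap_mem' := fun c => ⟨measurable_const, |c|, fun _ => le_rfl⟩

/-- The indicator function of a measurable set, as a bounded measurable function. -/
def indic {Ω : Type*} [MeasurableSpace Ω] (A : Set Ω) (hA : MeasurableSet A) : BddMeas Ω :=
  ⟨A.indicator (fun _ => (1 : ℝ)), measurable_const.indicator hA, 1, fun ω => by
    by_cases h : ω ∈ A <;> simp [h]⟩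

/-- A sublinear operator `ρ : 𝔽 → ℝ`. -/
structure IsSublinearOperator {Ω : Type*} [MeasurableSpace Ω] (ρ : BddMeas Ω → ℝ) : Prop where
  mono : ∀ ξ₁ ξ₂ : BddMeas Ω, (∀ ω, ξ₂.1 ω ≤ ξ₁.1 ω) → ρ ξ₂ ≤ ρ ξ₁
  const : ∀ c : ℝ, ρ (algebraMap ℝ (BddMeas Ω) c) = c
  subadd : ∀ ξ₁ ξ₂ : BddMeas Ω, ρ (ξ₁ + ξ₂) ≤ ρ ξ₁ + ρ ξ₂
  posHom : ∀ (l : ℝ) (ξ : BddMeas Ω), 0 ≤ l → ρ (l • ξ) = l * ρ ξ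

/-- Continuity from above: `ρ ξₙ → 0` whenever `ξₙ` decreases pointwise to `0`.  (That the
sequence `ρ ξₙ` is decreasing is automatic for a monotone `ρ`.) -/
def IsContinuousFromAbove {Ω : Type*} [MeasurableSpace Ω] (ρ : BddMeas Ω → ℝ) : Prop :=
  ∀ ξ : ℕ → BddMeas Ω, (∀ ω, Antitone fun n => (ξ n).1 ω) →
    (∀ ω, Tendsto (fun n => (ξ n).1 ω) atTop (𝓝 0)) →
    Tendsto (fun n => ρ (ξ n)) atTop (𝓝 0)

/-- The family `𝒫` of all linear operators on `𝔽` dominated by `ρ`. -/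
def dominated {Ω : Type*} [MeasurableSpace Ω] (ρ : BddMeas Ω → ℝ) :
    Set (BddMeas Ω →ₗ[ℝ] ℝ) :=
  {E | ∀ ξ : BddMeas Ω, E ξ ≤ ρ ξ}

/-- `ρ` is proper, with reference probability measure `P₀`: every element of `𝒫` is equivalent
to `P₀`.  Here the additive set function `P` corresponding to the linear operator `E` is
`P A = E 1_A`, and equivalence means having the same null sets. -/
def IsProper {Ω : Type*} [MeasurableSpace Ω] (ρ : BddMeas Ω → ℝ) (P₀ : Measure Ω) : Prop :=
  ∀ E ∈ dominated ρ, ∀ (A : Set Ω) (hA : MeasurableSet A), E (indic A hA) = 0 ↔ P₀ A = 0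

/-- `η` is a minimum mean square estimator of `ξ` given the sub-σ-algebra `C`, i.e. a version of
`ρ(ξ | C)`: it is a bounded `C`-measurable function that minimizes `ρ ((ξ - η) ^ 2)` among all
bounded `C`-measurable functions. -/
def IsMinMeanSquareEstimator {Ω : Type*} (C : MeasurableSpace Ω) [MeasurableSpace Ω]
    (ρ : BddMeas Ω → ℝ) (ξ η : BddMeas Ω) : Prop :=
  Measurable[C] η.1 ∧
    ∀ η' : BddMeas Ω, Measurable[C] η'.1 → ρ ((ξ - η) ^ 2) ≤ ρ ((ξ - η') ^ 2)

/-- Under the additive set function `P A = E 1_A`, the function `ξ` is independent of the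
sub-σ-algebra `C`: `P (A ∩ B) = P A * P B` for all `A ∈ σ(ξ)` and `B ∈ C`. -/
def IsIndepOf {Ω : Type*} (C : MeasurableSpace Ω) [MeasurableSpace Ω]
    (E : BddMeas Ω →ₗ[ℝ] ℝ) (ξ : BddMeas Ω) : Prop :=
  ∀ (A B : Set Ω) (hA : MeasurableSet A) (hB : MeasurableSet B),
    MeasurableSet[MeasurableSpace.comap ξ.1 (borel ℝ)] A → MeasurableSet[C] B →
    E (indic (A ∩ B) (hA.inter hB)) = E (indic A hA) * E (indic B hB)

end

/-!
The functional `η ↦ ρ ((ξ - η) ^ 2)` is convex, and a truncation of `η` at a bound of `ξ` does not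
increase it. In `L²(P₀)` the bounded almost minimizers form a decreasing sequence of
midpoint-convex sets, from which the parallelogram law extracts an almost surely convergent
minimizing sequence (`exists_cauchySeq_of_antitone_midpoint`). Properness makes `P₀`-null sets
negligible for `ρ`, so continuity from above gives bounded convergence for `ρ`
(`tendsto_map_zero_of_ae_tendsto_zero`) and the limit is a minimizer
(`exists_isMinMeanSquareEstimator`).

Uniqueness (`IsMinMeanSquareEstimator.ae_eq`) comes from the Hahn–Banach theorem: a functional
`E ≤ ρ` that attains `ρ` at the squared error of the midpoint of two minimizers `η`, `η'` satisfies
`E ((η - η') ^ 2) ≤ 0`, hence `η = η'` almost surely because `E` has the null sets of `P₀`. The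
bounds, homogeneity and translation properties then only require that the truncated, scaled or
translated function is again a minimizer.

In the independent case, let `c` be the best constant, that is, a minimizer for the trivial
σ-algebra. Its optimality along constants provides `E ≤ ρ` with `E ((ξ - c) ^ 2) = ρ ((ξ - c) ^ 2)`
and `E (ξ - c) = 0` (`exists_linear_le_sublinear_of_forall_le`). Independence under `E` gives
`E ((ξ - η) ^ 2) = E ((ξ - c) ^ 2) + E ((c - η) ^ 2)` for all bounded `C`-measurable `η`, so `c` is
a minimizer for `C` too (`exists_const_isMinMeanSquareEstimator`).
-/

/-! ### Hahn–Banach for sublinear functionals -/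

theorem exists_linear_le_sublinear {V : Type*} [AddCommGroup V] [Module ℝ V] (N : V → ℝ)
    (hom : ∀ c : ℝ, 0 < c → ∀ x, N (c • x) = c * N x) (hadd : ∀ x y, N (x + y) ≤ N x + N y)
    (x : V) : ∃ g : V →ₗ[ℝ] ℝ, (∀ y, g y ≤ N y) ∧ g x = N x := by
  have h0 : N 0 = 0 := by
    have := hom 2 two_pos 0
    rw [smul_zero] at this
    linarith
  have H : ∀ c : ℝ, c • x = 0 → c • N x = 0 := by
    intro c hc
    rcases smul_eq_zero.1 hc with h | h
    · simp [h]
    · simp [h, h0]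
  let f : V →ₗ.[ℝ] ℝ := LinearPMap.mkSpanSingleton' x (N x) H
  obtain ⟨g, hg, hgN⟩ := exists_extension_of_le_sublinear f N hom hadd (by
      rintro ⟨y, hy⟩
      obtain ⟨c, rfl⟩ := Submodule.mem_span_singleton.1 hy
      have hc : f ⟨c • x, hy⟩ = c * N x := LinearPMap.mkSpanSingleton'_apply _ _ _ _ _
      rw [hc]
      rcases lt_trichotomy c 0 with hc | rfl | hc
      · have h1 := hom (-c) (neg_pos.2 hc) x
        have h2 := hadd (c • x) ((-c) • x)
        rw [← add_smul, add_neg_cancel, zero_smul, h0] at h2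
        linarith
      · simp [h0]
      · exact (hom c hc x).ge)
  refine ⟨g, hgN, ?_⟩
  have hx : x ∈ f.domain := Submodule.mem_span_singleton_self x
  exact (hg ⟨x, hx⟩).trans (LinearPMap.mkSpanSingleton'_apply_self _ _ _ _)

/-- If `y` minimizes `N` on the line `y + ℝ z`, then a supporting functional of `N` at `y` can be
chosen to vanish at `z`: extend from the span of `y` below the sublinear functional
`x ↦ inf_t N (x + t z)`, which agrees with `N` at `y` and is nonpositive at `z` and `-z`. -/
theorem exists_linear_le_sublinear_of_forall_le {V : Type*} [AddCommGroup V] [Module ℝ V]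
    (N : V → ℝ) (hom : ∀ c : ℝ, 0 < c → ∀ x, N (c • x) = c * N x)
    (hadd : ∀ x y, N (x + y) ≤ N x + N y) (y z : V) (hmin : ∀ t : ℝ, N y ≤ N (y + t • z)) :
    ∃ g : V →ₗ[ℝ] ℝ, (∀ x, g x ≤ N x) ∧ g y = N y ∧ g z = 0 := by
  have h0 : N 0 = 0 := by
    have := hom 2 two_pos 0
    rw [smul_zero] at this
    linarith
  have hz : ∀ t : ℝ, 0 ≤ N (t • z) := fun t => by
    have := hmin t
    have := hadd y (t • z)
    linarith
  have hbdd : ∀ x, BddBelow (Set.range fun t : ℝ => N (x + t • z)) := by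
    intro x
    refine ⟨-N (-x), ?_⟩
    rintro _ ⟨t, rfl⟩
    have h1 := hadd (x + t • z) (-x)
    rw [show x + t • z + -x = t • z by abel] at h1
    have := hz t
    dsimp only
    linarith
  have hle : ∀ x (t : ℝ), (⨅ t : ℝ, N (x + t • z)) ≤ N (x + t • z) := fun x t => ciInf_le (hbdd x) t
  obtain ⟨g, hg, hgy⟩ := exists_linear_le_sublinear (fun x => ⨅ t : ℝ, N (x + t • z))
    (by
      intro c hc x
      rw [Real.mul_iInf_of_nonneg hc.le]
      refine Equiv.iInf_congr (Equiv.mulLeft₀ c⁻¹ (inv_ne_zero hc.ne')) fun t => ?_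
      rw [← hom c hc, smul_add, smul_smul]
      change N (c • x + (c * (c⁻¹ * t)) • z) = _
      rw [mul_inv_cancel_left₀ hc.ne'])
    (by
      intro x x'
      refine le_ciInf_add_ciInf fun s t => (hle _ (s + t)).trans ?_
      refine le_of_eq_of_le (congrArg N ?_) (hadd _ _)
      rw [add_smul]
      abel)
    y
  refine ⟨g, fun x => (hg x).trans (by simpa using hle x 0), ?_, le_antisymm ?_ ?_⟩
  · rw [hgy]
    exact le_antisymm (by simpa using hle y 0) (le_ciInf hmin)
  · refine (hg z).trans ((hle z (-1)).trans ?_)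
    simp [h0]
  · have h1 : g (-z) ≤ 0 := (hg (-z)).trans ((hle (-z) 1).trans (by simp [h0]))
    rw [map_neg] at h1
    linarith

/-! ### Cauchy sequences in decreasing families of convex sets -/

/-- Elements of almost minimal norm of a decreasing sequence of bounded midpoint-convex sets form
a Cauchy sequence: the minimal norms increase to a finite limit, and the parallelogram law turns
this into an estimate of the distances. -/
theorem exists_cauchySeq_of_antitone_midpoint {E : Type*} [NormedAddCommGroup E]
    [InnerProductSpace ℝ E] (K : ℕ → Set E) (hanti : Antitone K) (hne : ∀ n, (K n).Nonempty)
    (hmid : ∀ n, ∀ x ∈ K n, ∀ y ∈ K n, (1 / 2 : ℝ) • (x + y) ∈ K n) (R : ℝ)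
    (hR : ∀ x ∈ K 0, ‖x‖ ≤ R) : ∃ x : ℕ → E, (∀ n, x n ∈ K n) ∧ CauchySeq x := by
  set d : ℕ → ℝ := fun n => sInf ((fun x : E => ‖x‖ ^ 2) '' K n) with hd
  have hbdd : ∀ n, BddBelow ((fun x : E => ‖x‖ ^ 2) '' K n) := fun n =>
    ⟨0, by rintro _ ⟨x, -, rfl⟩; positivity⟩
  have hdle : ∀ n, ∀ x ∈ K n, d n ≤ ‖x‖ ^ 2 := fun n x hx => csInf_le (hbdd n) ⟨x, hx, rfl⟩
  have hdmono : Monotone d := fun m n hmn =>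
    csInf_le_csInf (hbdd m) ((hne n).image _) (Set.image_mono (hanti hmn))
  have hdR : BddAbove (Set.range d) := by
    refine ⟨R ^ 2, ?_⟩
    rintro _ ⟨n, rfl⟩
    obtain ⟨x, hx⟩ := hne n
    exact (hdle n x hx).trans (pow_le_pow_left₀ (norm_nonneg _) (hR x (hanti (Nat.zero_le n) hx)) 2)
  have hlim := tendsto_atTop_ciSup hdmono hdR
  set D := ⨆ n, d n
  have hdD : ∀ n, d n ≤ D := fun n => le_ciSup hdR n
  have hex : ∀ n : ℕ, ∃ x ∈ K n, ‖x‖ ^ 2 < d n + 1 / ((n : ℝ) + 1) := by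
    intro n
    obtain ⟨_, ⟨x, hx, rfl⟩, h⟩ := exists_lt_of_csInf_lt ((hne n).image _)
      (lt_add_of_pos_right (d n) (Nat.one_div_pos_of_nat (α := ℝ) (n := n)))
    exact ⟨x, hx, h⟩
  choose x hxK hx using hex
  refine ⟨x, hxK, cauchySeq_of_le_tendsto_0
    (fun n : ℕ => Real.sqrt (4 * (D - d n) + 4 * (1 / ((n : ℝ) + 1)))) ?_ ?_⟩
  · intro n m N hn hm
    rw [dist_eq_norm]
    apply Real.le_sqrt_of_sq_le
    have h1 := parallelogram_law_with_norm ℝ (x n) (x m)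
    have h2 := hdle N _ (hmid N _ (hanti hn (hxK n)) _ (hanti hm (hxK m)))
    rw [norm_smul, mul_pow] at h2
    norm_num at h2
    have h3 := hx n
    have h4 := hx m
    have h5 : 1 / ((n : ℝ) + 1) ≤ 1 / ((N : ℝ) + 1) := Nat.one_div_le_one_div hn
    have h6 : 1 / ((m : ℝ) + 1) ≤ 1 / ((N : ℝ) + 1) := Nat.one_div_le_one_div hm
    have h7 := hdD n
    have h8 := hdD m
    nlinarith
  · have h1 : Tendsto (fun n : ℕ => 4 * (D - d n) + 4 * (1 / ((n : ℝ) + 1))) atTop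
        (𝓝 (4 * (D - D) + 4 * 0)) :=
      ((tendsto_const_nhds.sub hlim).const_mul 4).add
        (tendsto_one_div_add_atTop_nhds_zero_nat.const_mul 4)
    simpa using h1.sqrt

/-! ### Sublinear operators and the linear functionals below them -/

section Dominated

variable {Ω : Type*} {C : MeasurableSpace Ω} [mΩ : MeasurableSpace Ω] {ρ : BddMeas Ω → ℝ}

theorem IsSublinearOperator.map_zero (hρ : IsSublinearOperator ρ) : ρ 0 = 0 := by
  simpa using hρ.const 0

theorem IsSublinearOperator.map_nonneg (hρ : IsSublinearOperator ρ) {X : BddMeas Ω}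
    (hX : ∀ ω, 0 ≤ X.1 ω) : 0 ≤ ρ X :=
  hρ.map_zero ▸ hρ.mono X 0 hX

theorem map_nonneg_of_mem_dominated (hρ : IsSublinearOperator ρ) {E : BddMeas Ω →ₗ[ℝ] ℝ}
    (hE : E ∈ dominated ρ) {X : BddMeas Ω} (hX : ∀ ω, 0 ≤ X.1 ω) : 0 ≤ E X := by
  have h1 : E (-X) ≤ ρ (-X) := hE _
  have h2 : ρ (-X) ≤ ρ 0 := hρ.mono 0 (-X) fun ω => neg_nonpos.2 (hX ω)
  rw [map_neg] at h1
  rw [hρ.map_zero] at h2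
  linarith

theorem map_mono_of_mem_dominated (hρ : IsSublinearOperator ρ) {E : BddMeas Ω →ₗ[ℝ] ℝ}
    (hE : E ∈ dominated ρ) {X Y : BddMeas Ω} (h : ∀ ω, X.1 ω ≤ Y.1 ω) : E X ≤ E Y := by
  have := map_nonneg_of_mem_dominated hρ hE (X := Y - X) fun ω => sub_nonneg.2 (h ω)
  rw [map_sub] at this
  linarith

theorem abs_map_le_of_mem_dominated (hρ : IsSublinearOperator ρ) {E : BddMeas Ω →ₗ[ℝ] ℝ}
    (hE : E ∈ dominated ρ) {X : BddMeas Ω} {ε : ℝ} (h : ∀ ω, |X.1 ω| ≤ ε) : |E X| ≤ ε := by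
  have key : ∀ Y : BddMeas Ω, (∀ ω, Y.1 ω ≤ ε) → E Y ≤ ε := fun Y hY =>
    (hE Y).trans ((hρ.mono (algebraMap ℝ _ ε) Y hY).trans_eq (hρ.const ε))
  refine abs_le'.2 ⟨key X fun ω => (abs_le'.1 (h ω)).1, ?_⟩
  rw [← map_neg]
  exact key (-X) fun ω => (abs_le'.1 (h ω)).2

theorem exists_mem_dominated_eq (hρ : IsSublinearOperator ρ) (X : BddMeas Ω) :
    ∃ E ∈ dominated ρ, E X = ρ X := by
  obtain ⟨E, hE, h⟩ := exists_linear_le_sublinear ρ (fun c hc x => hρ.posHom c x hc.le) hρ.subadd X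
  exact ⟨E, hE, h⟩

/-- A bounded function `X` lies within uniform distance `1 / N` of a linear combination of the
indicators of its level sets `{⌊N X⌋ = k}`, so a linear functional that is bounded for the uniform norm and vanishes on
indicators of `C`-measurable sets vanishes on all bounded `C`-measurable functions. -/
theorem map_eq_zero_of_indic (hC : C ≤ mΩ) (L : BddMeas Ω →ₗ[ℝ] ℝ)
    (K : ℝ) (hL : ∀ (X : BddMeas Ω) (ε : ℝ), (∀ ω, |X.1 ω| ≤ ε) → |L X| ≤ K * ε)
    (hind : ∀ (A : Set Ω) (hA : MeasurableSet[C] A), L (indic A (hC A hA)) = 0)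
    (X : BddMeas Ω) (hX : Measurable[C] X.1) : L X = 0 := by
  obtain ⟨M, hM⟩ := X.2.2
  have hbound : ∀ N : ℕ, |L X| ≤ K * (1 / ((N : ℝ) + 1)) := by
    intro N
    have hN : (0 : ℝ) < (N : ℝ) + 1 := by positivity
    have hAm : ∀ k : ℤ, MeasurableSet[C] {ω | ⌊((N : ℝ) + 1) * X.1 ω⌋ = k} := fun k =>
      (Int.measurable_floor.comp (hX.const_mul ((N : ℝ) + 1))) (measurableSet_singleton k)
    set S : Finset ℤ := Finset.Icc ⌊((N : ℝ) + 1) * (-M)⌋ ⌊((N : ℝ) + 1) * M⌋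
    set Y : BddMeas Ω := ∑ k ∈ S, ((k : ℝ) / ((N : ℝ) + 1)) • indic _ (hC _ (hAm k)) with hY
    have hLY : L Y = 0 := by
      rw [hY, map_sum]
      exact Finset.sum_eq_zero fun k _ => by rw [map_smul, hind _ (hAm k), smul_zero]
    have hYω : ∀ ω, Y.1 ω = (⌊((N : ℝ) + 1) * X.1 ω⌋ : ℝ) / ((N : ℝ) + 1) := by
      intro ω
      have hmem : ⌊((N : ℝ) + 1) * X.1 ω⌋ ∈ S := by
        have := abs_le.1 (hM ω)
        exact Finset.mem_Icc.2 ⟨Int.floor_le_floor (mul_le_mul_of_nonneg_left this.1 hN.le),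
          Int.floor_le_floor (mul_le_mul_of_nonneg_left this.2 hN.le)⟩
      have h1 : Y.1 ω = ∑ k ∈ S, (k : ℝ) / ((N : ℝ) + 1) *
          Set.indicator {ω | ⌊((N : ℝ) + 1) * X.1 ω⌋ = k} (fun _ => (1 : ℝ)) ω := by
        rw [hY, AddSubmonoidClass.coe_finsetSum, Finset.sum_apply]
        rfl
      rw [h1, Finset.sum_eq_single_of_mem _ hmem]
      · simp
      · intro k _ hk
        simp [Set.indicator, hk.symm]
    have := hL (X - Y) (1 / ((N : ℝ) + 1)) fun ω => by
      change |X.1 ω - Y.1 ω| ≤ _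
      rw [hYω, show X.1 ω - (⌊((N : ℝ) + 1) * X.1 ω⌋ : ℝ) / ((N : ℝ) + 1)
        = Int.fract (((N : ℝ) + 1) * X.1 ω) / ((N : ℝ) + 1) by
          rw [Int.fract]; field_simp, abs_div, abs_of_pos hN, Int.abs_fract]
      exact div_le_div_of_nonneg_right (Int.fract_lt_one _).le hN.le
    rwa [map_sub, hLY, sub_zero] at this
  have hlim : Tendsto (fun N : ℕ => K * (1 / ((N : ℝ) + 1))) atTop (𝓝 (K * 0)) :=
    tendsto_one_div_add_atTop_nhds_zero_nat.const_mul K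
  rw [mul_zero] at hlim
  exact abs_nonpos_iff.1 (ge_of_tendsto' hlim hbound)

theorem map_mul_of_indic (hρ : IsSublinearOperator ρ) (hC : C ≤ mΩ)
    {E : BddMeas Ω →ₗ[ℝ] ℝ} (hE : E ∈ dominated ρ) (Z : BddMeas Ω)
    (hZ : ∀ (A : Set Ω) (hA : MeasurableSet[C] A),
      E (Z * indic A (hC A hA)) = E Z * E (indic A (hC A hA)))
    (X : BddMeas Ω) (hX : Measurable[C] X.1) : E (Z * X) = E Z * E X := by
  obtain ⟨M, hM⟩ := Z.2.2
  refine sub_eq_zero.1 (map_eq_zero_of_indic hC (E ∘ₗ LinearMap.mulLeft ℝ Z - E Z • E)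
    (M + |E Z|) (fun X ε hX => ?_) (fun A hA => sub_eq_zero.2 (hZ A hA)) X hX)
  change |E (Z * X) - E Z * E X| ≤ _
  have h1 : |E (Z * X)| ≤ M * ε := abs_map_le_of_mem_dominated hρ hE fun ω => by
    change |Z.1 ω * X.1 ω| ≤ _
    rw [abs_mul]
    exact mul_le_mul (hM ω) (hX ω) (abs_nonneg _) ((abs_nonneg _).trans (hM ω))
  have h2 : |E X| ≤ ε := abs_map_le_of_mem_dominated hρ hE hX
  calc |E (Z * X) - E Z * E X| ≤ |E (Z * X)| + |E Z * E X| := abs_sub _ _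
    _ ≤ M * ε + |E Z| * ε := by
      rw [abs_mul]
      exact add_le_add h1 (mul_le_mul_of_nonneg_left h2 (abs_nonneg _))
    _ = _ := by ring

/-- Independence of sets under `E` extends to bounded functions, in each argument by uniform
approximation with linear combinations of indicators. -/
theorem IsIndepOf.map_mul (hρ : IsSublinearOperator ρ) (hC : C ≤ mΩ)
    {E : BddMeas Ω →ₗ[ℝ] ℝ} (hE : E ∈ dominated ρ) {ξ : BddMeas Ω} (h : IsIndepOf C E ξ)
    {η : BddMeas Ω} (hη : Measurable[C] η.1) : E (ξ * η) = E ξ * E η := by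
  refine map_mul_of_indic hρ hC hE ξ (fun B hB => ?_) η hη
  rw [mul_comm ξ, mul_comm (E ξ)]
  have hσ : MeasurableSpace.comap ξ.1 (borel ℝ) ≤ mΩ := ξ.2.1.comap_le
  refine map_mul_of_indic hρ hσ hE _ (fun A hA => ?_) ξ (comap_measurable ξ.1)
  rw [mul_comm, mul_comm (E _), ← h A B (hσ A hA) (hC B hB) hA hB]
  congr 1
  ext ω
  change A.indicator (fun _ => (1 : ℝ)) ω * B.indicator (fun _ => (1 : ℝ)) ω
    = (A ∩ B).indicator (fun _ => (1 : ℝ)) ω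
  by_cases h1 : ω ∈ A <;> by_cases h2 : ω ∈ B <;> simp [h1, h2]

/-! ### Null sets and convergence -/

theorem ae_eq_zero_of_map_eq_zero (hρ : IsSublinearOperator ρ) {P₀ : Measure Ω}
    (hproper : IsProper ρ P₀) {E : BddMeas Ω →ₗ[ℝ] ℝ} (hE : E ∈ dominated ρ) {X : BddMeas Ω}
    (hX : ∀ ω, 0 ≤ X.1 ω) (h : E X = 0) : ∀ᵐ ω ∂P₀, X.1 ω = 0 := by
  have hA : ∀ n : ℕ, MeasurableSet {ω | 1 / ((n : ℝ) + 1) ≤ X.1 ω} := fun n =>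
    measurableSet_le measurable_const X.2.1
  have hnull : ∀ n : ℕ, ∀ᵐ ω ∂P₀, ¬ 1 / ((n : ℝ) + 1) ≤ X.1 ω := by
    intro n
    rw [ae_iff]
    simp only [not_not]
    refine (hproper E hE _ (hA n)).1 (le_antisymm ?_ (map_nonneg_of_mem_dominated hρ hE
      fun ω => Set.indicator_nonneg (fun _ _ => zero_le_one) ω))
    have := map_mono_of_mem_dominated hρ hE (X := indic _ (hA n)) (Y := ((n : ℝ) + 1) • X)
      fun ω => by
        change Set.indicator _ (fun _ => (1 : ℝ)) ω ≤ ((n : ℝ) + 1) * X.1 ω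
        have hn : (0 : ℝ) < (n : ℝ) + 1 := by positivity
        refine Set.indicator_apply_le' (fun hω => ?_) fun _ => mul_nonneg hn.le (hX ω)
        rw [Set.mem_ofPred_eq, div_le_iff₀' hn] at hω
        exact hω
    rwa [map_smul, h, smul_zero] at this
  filter_upwards [ae_all_iff.2 hnull] with ω hω
  refine le_antisymm (le_of_not_gt fun hpos => ?_) (hX ω)
  obtain ⟨n, hn⟩ := exists_nat_one_div_lt hpos
  exact hω n hn.le

theorem IsSublinearOperator.map_indic_eq_zero (hρ : IsSublinearOperator ρ) {P₀ : Measure Ω}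
    (hproper : IsProper ρ P₀) {A : Set Ω} (hA : MeasurableSet A) (h : P₀ A = 0) :
    ρ (indic A hA) = 0 := by
  obtain ⟨E, hE, hEA⟩ := exists_mem_dominated_eq hρ (indic A hA)
  rw [← hEA]
  exact (hproper E hE A hA).2 h

/-- Bounded convergence for `ρ`: off a null set the tail suprema of the sequence decrease to `0`,
where continuity from above applies, and the null set does not contribute. -/
theorem tendsto_map_zero_of_ae_tendsto_zero (hρ : IsSublinearOperator ρ)
    (hcont : IsContinuousFromAbove ρ) {P₀ : Measure Ω} (hproper : IsProper ρ P₀)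
    (Y : ℕ → BddMeas Ω) (hY : ∀ n ω, 0 ≤ (Y n).1 ω) {B : ℝ} (hB : ∀ n ω, (Y n).1 ω ≤ B)
    (hlim : ∀ᵐ ω ∂P₀, Tendsto (fun n => (Y n).1 ω) atTop (𝓝 0)) :
    Tendsto (fun n => ρ (Y n)) atTop (𝓝 0) := by
  obtain ⟨A, hsub, hA, hA0⟩ := exists_measurable_superset_of_null (ae_iff.1 hlim)
  have hbdd : ∀ n ω, BddAbove (Set.range fun k => (Y (n + k)).1 ω) := fun n ω =>
    ⟨B, by rintro _ ⟨k, rfl⟩; exact hB _ _⟩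
  have hB' : ∀ n ω, ⨆ k : ℕ, (Y (n + k)).1 ω ≤ B := fun n ω => ciSup_le fun k => hB _ _
  have h0 : ∀ n ω, 0 ≤ ⨆ k : ℕ, (Y (n + k)).1 ω := fun n ω =>
    (hY (n + 0) ω).trans (le_ciSup (hbdd n ω) 0)
  let S : ℕ → BddMeas Ω := fun n => ⟨Aᶜ.indicator fun ω => ⨆ k : ℕ, (Y (n + k)).1 ω,
    (Measurable.iSup fun k => (Y (n + k)).2.1).indicator hA.compl, B, fun ω => by
      by_cases hω : ω ∈ A
      · simpa [hω] using (h0 n ω).trans (hB' n ω)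
      · simpa [hω, abs_of_nonneg (h0 n ω)] using hB' n ω⟩
  have hS : Tendsto (fun n => ρ (S n)) atTop (𝓝 0) := by
    refine hcont S (fun ω m n hmn => ?_) fun ω => ?_
    · have hle : ⨆ k : ℕ, (Y (n + k)).1 ω ≤ ⨆ k : ℕ, (Y (m + k)).1 ω := by
        refine ciSup_le fun k => ?_
        obtain ⟨j, rfl⟩ := Nat.exists_eq_add_of_le hmn
        rw [add_assoc]
        exact le_ciSup (hbdd m ω) (j + k)
      change Aᶜ.indicator (fun ω => ⨆ k : ℕ, (Y (n + k)).1 ω) ω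
        ≤ Aᶜ.indicator (fun ω => ⨆ k : ℕ, (Y (m + k)).1 ω) ω
      exact Set.indicator_le_indicator hle
    · change Tendsto (fun n => Aᶜ.indicator (fun ω => ⨆ k : ℕ, (Y (n + k)).1 ω) ω) atTop (𝓝 0)
      by_cases hω : ω ∈ A
      · simp [hω]
      · have hω' : Tendsto (fun n => (Y n).1 ω) atTop (𝓝 0) := by
          by_contra hcon
          exact hω (hsub hcon)
        simp only [Set.indicator_of_mem (Set.mem_compl hω)]
        rw [Metric.tendsto_atTop] at hω' ⊢
        intro ε hε
        obtain ⟨N, hN⟩ := hω' (ε / 2) (half_pos hε)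
        refine ⟨N, fun n hn => ?_⟩
        rw [Real.dist_0_eq_abs, abs_of_nonneg (h0 n ω)]
        refine (ciSup_le fun k => ?_).trans_lt (half_lt_self hε)
        have := hN (n + k) (by omega)
        rw [Real.dist_0_eq_abs, abs_of_nonneg (hY _ ω)] at this
        exact this.le
  refine squeeze_zero (fun n => hρ.map_nonneg (hY n)) (fun n => ?_) hS
  have hBA : ρ (max B 0 • indic A hA) = 0 := by
    rw [hρ.posHom _ _ (le_max_right _ _), hρ.map_indic_eq_zero hproper hA hA0, mul_zero]
  have h1 := hρ.subadd (S n) (max B 0 • indic A hA)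
  rw [hBA, add_zero] at h1
  refine (hρ.mono _ _ fun ω => ?_).trans h1
  change _ ≤ Aᶜ.indicator (fun ω => ⨆ k : ℕ, (Y (n + k)).1 ω) ω
    + max B 0 * A.indicator (fun _ => (1 : ℝ)) ω
  by_cases hω : ω ∈ A
  · simpa [hω] using Or.inl (hB n ω)
  · simpa [hω] using le_ciSup (hbdd n ω) 0

end Dominated

/-! ### The mean square risk -/

section Estimator

variable {Ω : Type*} {C : MeasurableSpace Ω} [mΩ : MeasurableSpace Ω] {ρ : BddMeas Ω → ℝ}

theorem BddMeas.sub_sq_apply (ξ η : BddMeas Ω) (ω : Ω) :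
    ((ξ - η) ^ 2 : BddMeas Ω).1 ω = (ξ.1 ω - η.1 ω) ^ 2 :=
  rfl

/-- The function `η` truncated to the interval `[a, b]`, as a bounded measurable function. -/
noncomputable def BddMeas.clip (a b : ℝ) (η : BddMeas Ω) : BddMeas Ω :=
  ⟨fun ω => max a (min b (η.1 ω)), measurable_const.max (measurable_const.min η.2.1),
    |a| + |b|, fun ω => by
      have h1 := neg_abs_le a
      have h2 := le_abs_self b
      have h3 := le_abs_self a
      have h4 := abs_nonneg a
      have h5 := abs_nonneg b
      refine abs_le.2 ⟨le_max_of_le_left (by linarith), max_le (by linarith) ?_⟩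
      exact (min_le_left _ _).trans (by linarith)⟩

theorem BddMeas.measurable_clip {η : BddMeas Ω} (hη : Measurable[C] η.1) (a b : ℝ) :
    Measurable[C] (BddMeas.clip a b η).1 :=
  Measurable.max (@measurable_const _ _ _ C a) (Measurable.min (@measurable_const _ _ _ C b) hη)

theorem BddMeas.measurable_smul {η : BddMeas Ω} (hη : Measurable[C] η.1) (l : ℝ) :
    Measurable[C] (l • η).1 :=
  Measurable.const_smul hη l

theorem IsSublinearOperator.map_sub_clip_sq_le (hρ : IsSublinearOperator ρ) {a b : ℝ}
    {ξ : BddMeas Ω} (hξ : ∀ ω, a ≤ ξ.1 ω ∧ ξ.1 ω ≤ b) (η : BddMeas Ω) :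
    ρ ((ξ - BddMeas.clip a b η) ^ 2) ≤ ρ ((ξ - η) ^ 2) := by
  refine hρ.mono _ _ fun ω => ?_
  rw [BddMeas.sub_sq_apply, BddMeas.sub_sq_apply]
  obtain ⟨h1, h2⟩ := hξ ω
  change (ξ.1 ω - max a (min b (η.1 ω))) ^ 2 ≤ _
  rcases le_total b (η.1 ω) with h | h
  · rw [min_eq_left h, max_eq_right (h1.trans h2)]
    nlinarith
  · rw [min_eq_right h]
    rcases le_total a (η.1 ω) with h' | h'
    · rw [max_eq_right h']
    · rw [max_eq_left h']
      nlinarith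

theorem BddMeas.sub_midpoint_sq (ξ η η' : BddMeas Ω) :
    (ξ - (1 / 2 : ℝ) • (η + η')) ^ 2 + (1 / 4 : ℝ) • (η - η') ^ 2
      = (1 / 2 : ℝ) • (ξ - η) ^ 2 + (1 / 2 : ℝ) • (ξ - η') ^ 2 := by
  ext ω
  change (ξ.1 ω - (1 / 2 : ℝ) * (η.1 ω + η'.1 ω)) ^ 2 + (1 / 4 : ℝ) * (η.1 ω - η'.1 ω) ^ 2
      = (1 / 2 : ℝ) * (ξ.1 ω - η.1 ω) ^ 2 + (1 / 2 : ℝ) * (ξ.1 ω - η'.1 ω) ^ 2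
  ring

theorem IsSublinearOperator.map_sub_midpoint_sq_le (hρ : IsSublinearOperator ρ)
    (ξ η η' : BddMeas Ω) : ρ ((ξ - (1 / 2 : ℝ) • (η + η')) ^ 2)
      ≤ 1 / 2 * ρ ((ξ - η) ^ 2) + 1 / 2 * ρ ((ξ - η') ^ 2) := by
  rw [← hρ.posHom _ _ (by norm_num), ← hρ.posHom _ _ (by norm_num)]
  refine le_trans (hρ.mono _ _ fun ω => ?_) (hρ.subadd _ _)
  rw [← BddMeas.sub_midpoint_sq]
  refine le_add_of_nonneg_right ?_
  change 0 ≤ (1 / 4 : ℝ) * (η.1 ω - η'.1 ω) ^ 2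
  positivity

theorem BddMeas.memLp (P₀ : Measure Ω) [IsFiniteMeasure P₀] (η : BddMeas Ω) :
    MemLp η.1 2 P₀ := by
  obtain ⟨M, hM⟩ := η.2.2
  exact MemLp.of_bound η.2.1.aestronglyMeasurable M (ae_of_all _ hM)

/-! ### Existence and uniqueness of the estimator -/

/-- A minimizing sequence may be truncated at a bound of `ξ`. The almost minimizers form
decreasing midpoint-convex bounded sets in `L²(P₀)`, so a minimizing sequence can be chosen
convergent in `L²(P₀)`, hence almost surely along a subsequence; bounded convergence for `ρ` shows
that the limit is a minimizer. -/
theorem exists_isMinMeanSquareEstimator (hρ : IsSublinearOperator ρ)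
    (hcont : IsContinuousFromAbove ρ) (P₀ : Measure Ω) [IsProbabilityMeasure P₀]
    (hproper : IsProper ρ P₀) (hC : C ≤ mΩ) (ξ : BddMeas Ω) :
    ∃ η : BddMeas Ω, IsMinMeanSquareEstimator C ρ ξ η := by
  obtain ⟨M, hM⟩ := ξ.2.2
  obtain ⟨ω₀⟩ := nonempty_of_isProbabilityMeasure P₀
  have hM0 : 0 ≤ M := (abs_nonneg _).trans (hM ω₀)
  set F : BddMeas Ω → ℝ := fun η => ρ ((ξ - η) ^ 2) with hF
  have hF0 : ∀ η, 0 ≤ F η := fun η => hρ.map_nonneg fun ω => sq_nonneg (ξ.1 ω - η.1 ω)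
  set v := sInf (F '' {η | Measurable[C] η.1})
  have hbdd : BddBelow (F '' {η | Measurable[C] η.1}) :=
    ⟨0, by rintro _ ⟨η, -, rfl⟩; exact hF0 η⟩
  have hvle : ∀ η : BddMeas Ω, Measurable[C] η.1 → v ≤ F η := fun η hη =>
    csInf_le hbdd ⟨η, hη, rfl⟩
  let T : ℕ → Set (BddMeas Ω) := fun n =>
    {η | Measurable[C] η.1 ∧ (∀ ω, |η.1 ω| ≤ M) ∧ F η ≤ v + 1 / ((n : ℝ) + 1)}
  let J : BddMeas Ω → Lp ℝ 2 P₀ := fun η => (BddMeas.memLp P₀ η).toLp η.1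
  obtain ⟨x, hxT, hxc⟩ := exists_cauchySeq_of_antitone_midpoint (fun n => J '' T n)
    (fun m n hmn => Set.image_mono fun η hη =>
      ⟨hη.1, hη.2.1, hη.2.2.trans (by gcongr)⟩)
    (fun n => by
      have hne : (F '' {η | Measurable[C] η.1}).Nonempty :=
        ⟨F 0, 0, @measurable_const _ _ _ C (0 : ℝ), rfl⟩
      obtain ⟨_, ⟨η, hη, rfl⟩, hlt⟩ := exists_lt_of_csInf_lt hne
        (lt_add_of_pos_right v (Nat.one_div_pos_of_nat (α := ℝ) (n := n)))
      refine ⟨_, BddMeas.clip (-M) M η, ⟨BddMeas.measurable_clip hη _ _, fun ω => ?_, ?_⟩, rfl⟩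
      · exact abs_le.2 ⟨le_max_left _ _, max_le (by linarith) (min_le_left _ _)⟩
      · exact (hρ.map_sub_clip_sq_le (fun ω => abs_le.1 (hM ω)) η).trans hlt.le)
    (by
      rintro n _ ⟨η, hη, rfl⟩ _ ⟨η', hη', rfl⟩
      refine ⟨(1 / 2 : ℝ) • (η + η'), ⟨?_, fun ω => ?_, ?_⟩, ?_⟩
      · exact BddMeas.measurable_smul (η := η + η') (Measurable.add hη.1 hη'.1) _
      · change |(1 / 2 : ℝ) * (η.1 ω + η'.1 ω)| ≤ M
        have h1 := abs_le.1 (hη.2.1 ω)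
        have h2 := abs_le.1 (hη'.2.1 ω)
        exact abs_le.2 ⟨by linarith, by linarith⟩
      · have h1 := hρ.map_sub_midpoint_sq_le ξ η η'
        have h2 : F η ≤ _ := hη.2.2
        have h3 : F η' ≤ _ := hη'.2.2
        simp only [hF] at h2 h3 ⊢
        linarith
      · rfl)
    M
    (by
      rintro _ ⟨η, hη, rfl⟩
      have := Lp.norm_le_of_ae_bound (f := J η) hM0 (by
        filter_upwards [(BddMeas.memLp P₀ η).coeFn_toLp] with ω hω
        rw [hω]
        exact hη.2.1 ω)
      simpa [measureUnivNNReal] using this)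
  obtain ⟨y, hy⟩ := cauchySeq_tendsto_of_complete hxc
  obtain ⟨ns, hns, hae⟩ := (tendstoInMeasure_of_tendsto_Lp hy).exists_seq_tendsto_ae
  choose η hηT hηx using hxT
  have hlim : ∀ᵐ ω ∂P₀, Tendsto (fun i => (η (ns i)).1 ω) atTop (𝓝 (y ω)) := by
    filter_upwards [hae, ae_all_iff.2 fun i => (BddMeas.memLp P₀ (η (ns i))).coeFn_toLp] with ω h1 h2
    refine h1.congr fun i => ?_
    rw [← h2 i, ← hηx]
  have hmeas : Measurable[C] fun ω => max (-M) (min M (limsup (fun i => (η (ns i)).1 ω) atTop)) :=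
    Measurable.max (@measurable_const _ _ _ C _) (Measurable.min (@measurable_const _ _ _ C _)
      (Measurable.limsup fun i => (hηT (ns i)).1))
  -- The limit exists only almost surely; the truncated upper limit is a version of it that is
  -- `C`-measurable and bounded everywhere.
  let θ : BddMeas Ω := ⟨fun ω => max (-M) (min M (limsup (fun i => (η (ns i)).1 ω) atTop)),
    hmeas.mono hC le_rfl, M, fun ω =>
      abs_le.2 ⟨le_max_left _ _, max_le (by linarith) (min_le_left _ _)⟩⟩
  have hθM : ∀ ω, |θ.1 ω| ≤ M := fun ω =>
    abs_le.2 ⟨le_max_left _ _, max_le (by linarith) (min_le_left _ _)⟩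
  have hθ : ∀ᵐ ω ∂P₀, Tendsto (fun i => (η (ns i)).1 ω) atTop (𝓝 (θ.1 ω)) := by
    filter_upwards [hlim] with ω hω
    have h1 : y ω ≤ M := le_of_tendsto' hω fun i => (abs_le.1 ((hηT (ns i)).2.1 ω)).2
    have h2 : -M ≤ y ω := ge_of_tendsto' hω fun i => (abs_le.1 ((hηT (ns i)).2.1 ω)).1
    change Tendsto _ _ (𝓝 (max (-M) (min M (limsup (fun i => (η (ns i)).1 ω) atTop))))
    rwa [hω.limsup_eq, min_eq_right h1, max_eq_right h2]
  refine ⟨θ, hmeas, fun η' hη' => le_trans ?_ (hvle η' hη')⟩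
  have hYM : ∀ i ω, 4 * M * |(η (ns i)).1 ω - θ.1 ω| ≤ 4 * M * (2 * M) := by
    intro i ω
    refine mul_le_mul_of_nonneg_left ?_ (by linarith)
    have h1 := abs_le.1 (hθM ω)
    have h2 := abs_le.1 ((hηT (ns i)).2.1 ω)
    exact abs_le.2 ⟨by linarith, by linarith⟩
  have hY0 : ∀ i ω, 0 ≤ 4 * M * |(η (ns i)).1 ω - θ.1 ω| := fun i ω => by positivity
  let Y : ℕ → BddMeas Ω := fun i => ⟨fun ω => 4 * M * |(η (ns i)).1 ω - θ.1 ω|,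
    (((η (ns i)).2.1.sub θ.2.1).abs).const_mul _, _, fun ω =>
      (abs_of_nonneg (hY0 i ω)).le.trans (hYM i ω)⟩
  have hYlim : Tendsto (fun i => ρ (Y i)) atTop (𝓝 0) := by
    refine tendsto_map_zero_of_ae_tendsto_zero hρ hcont hproper Y hY0 hYM ?_
    filter_upwards [hθ] with ω hω
    simpa using ((hω.sub_const (θ.1 ω)).abs).const_mul (4 * M)
  have hFθ : ∀ i, F θ ≤ v + 1 / ((ns i : ℝ) + 1) + ρ (Y i) := by
    intro i
    refine le_trans ?_ (add_le_add_left (hηT (ns i)).2.2 _)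
    refine le_trans (hρ.mono _ _ fun ω => ?_) (hρ.subadd _ _)
    change (ξ.1 ω - θ.1 ω) ^ 2
      ≤ (ξ.1 ω - (η (ns i)).1 ω) ^ 2 + 4 * M * |(η (ns i)).1 ω - θ.1 ω|
    have h1 := abs_le.1 (hθM ω)
    have h2 := abs_le.1 ((hηT (ns i)).2.1 ω)
    have h3 := abs_le.1 (hM ω)
    have h4 : |2 * ξ.1 ω - θ.1 ω - (η (ns i)).1 ω| ≤ 4 * M :=
      abs_le.2 ⟨by linarith, by linarith⟩
    have h5 := mul_le_mul_of_nonneg_right h4 (abs_nonneg ((η (ns i)).1 ω - θ.1 ω))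
    rw [← abs_mul] at h5
    have h6 := le_abs_self ((2 * ξ.1 ω - θ.1 ω - (η (ns i)).1 ω) * ((η (ns i)).1 ω - θ.1 ω))
    nlinarith
  have hlim' : Tendsto (fun i => v + 1 / ((ns i : ℝ) + 1) + ρ (Y i)) atTop (𝓝 (v + 0 + 0)) :=
    (tendsto_const_nhds.add
      ((tendsto_one_div_add_atTop_nhds_zero_nat (𝕜 := ℝ)).comp hns.tendsto_atTop)).add hYlim
  rw [add_zero, add_zero] at hlim'
  exact ge_of_tendsto' hlim' hFθ

/-- A functional in `dominated ρ` that attains `ρ` at the squared error of the midpoint of two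
minimizers annihilates the square of their difference. -/
theorem IsMinMeanSquareEstimator.ae_eq (hρ : IsSublinearOperator ρ) {P₀ : Measure Ω}
    (hproper : IsProper ρ P₀) {ξ η η' : BddMeas Ω} (hη : IsMinMeanSquareEstimator C ρ ξ η)
    (hη' : IsMinMeanSquareEstimator C ρ ξ η') : η.1 =ᵐ[P₀] η'.1 := by
  obtain ⟨E, hE, hEeq⟩ := exists_mem_dominated_eq hρ ((ξ - (1 / 2 : ℝ) • (η + η')) ^ 2)
  have hmid : Measurable[C] ((1 / 2 : ℝ) • (η + η') : BddMeas Ω).1 :=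
    BddMeas.measurable_smul (η := η + η') (Measurable.add hη.1 hη'.1) _
  have h0 : ∀ ω, 0 ≤ ((1 / 4 : ℝ) • (η - η') ^ 2 : BddMeas Ω).1 ω := fun ω => by
    change 0 ≤ (1 / 4 : ℝ) * (η.1 ω - η'.1 ω) ^ 2
    positivity
  have hzero : E ((1 / 4 : ℝ) • (η - η') ^ 2) = 0 := by
    have h1 := congrArg E (BddMeas.sub_midpoint_sq ξ η η')
    rw [map_add, map_add, map_smul _ (1 / 2 : ℝ), map_smul _ (1 / 2 : ℝ), smul_eq_mul,
      smul_eq_mul, hEeq] at h1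
    have h2 := hE ((ξ - η) ^ 2)
    have h3 := hE ((ξ - η') ^ 2)
    have h4 := hη.2 _ hmid
    have h5 := hη'.2 _ hmid
    exact le_antisymm (by linarith) (map_nonneg_of_mem_dominated hρ hE h0)
  filter_upwards [ae_eq_zero_of_map_eq_zero hρ hproper hE h0 hzero] with ω hω
  change (1 / 4 : ℝ) * (η.1 ω - η'.1 ω) ^ 2 = 0 at hω
  have : (η.1 ω - η'.1 ω) ^ 2 = 0 := by linarith
  exact sub_eq_zero.1 (pow_eq_zero_iff two_ne_zero |>.1 this)

/-! ### Transformations of the estimator -/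

theorem IsMinMeanSquareEstimator.clip (hρ : IsSublinearOperator ρ) {a b : ℝ} {ξ η : BddMeas Ω}
    (hξ : ∀ ω, a ≤ ξ.1 ω ∧ ξ.1 ω ≤ b) (hη : IsMinMeanSquareEstimator C ρ ξ η) :
    IsMinMeanSquareEstimator C ρ ξ (BddMeas.clip a b η) :=
  ⟨BddMeas.measurable_clip hη.1 a b, fun η' hη' =>
    (hρ.map_sub_clip_sq_le hξ η).trans (hη.2 η' hη')⟩

theorem IsMinMeanSquareEstimator.smul (hρ : IsSublinearOperator ρ) {ξ η : BddMeas Ω}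
    (hη : IsMinMeanSquareEstimator C ρ ξ η) (l : ℝ) :
    IsMinMeanSquareEstimator C ρ (l • ξ) (l • η) := by
  refine ⟨BddMeas.measurable_smul hη.1 l, fun η' hη' => ?_⟩
  rcases eq_or_ne l 0 with rfl | hl
  · rw [zero_smul, zero_smul, sub_zero, zero_pow two_ne_zero, hρ.map_zero]
    exact hρ.map_nonneg fun ω => sq_nonneg (((0 : BddMeas Ω) - η').1 ω)
  · have h1 := hη.2 (l⁻¹ • η') (BddMeas.measurable_smul hη' l⁻¹)
    have h2 : l • ξ - η' = l • (ξ - l⁻¹ • η') := by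
      rw [smul_sub, smul_inv_smul₀ hl]
    rw [h2, ← smul_sub, smul_pow, smul_pow, hρ.posHom _ _ (sq_nonneg l),
      hρ.posHom _ _ (sq_nonneg l)]
    exact mul_le_mul_of_nonneg_left h1 (sq_nonneg l)

theorem IsMinMeanSquareEstimator.add {ξ η η₀ : BddMeas Ω}
    (hη : IsMinMeanSquareEstimator C ρ ξ η) (hη₀ : Measurable[C] η₀.1) :
    IsMinMeanSquareEstimator C ρ (ξ + η₀) (η + η₀) := by
  refine ⟨Measurable.add hη.1 hη₀, fun η' hη' => ?_⟩
  have h1 := hη.2 (η' - η₀) (Measurable.sub hη' hη₀)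
  rwa [add_sub_add_right_eq_sub, add_comm ξ, add_sub_assoc, add_comm η₀, sub_add]

/-! ### Independence -/

/-- First-order optimality of `η` along the constant functions: by convexity, the one-sided
derivatives of `t ↦ ρ ((ξ - η) ^ 2 + t (ξ - η))` at `0` have the signs of a minimum. -/
theorem IsMinMeanSquareEstimator.le_map_add_smul (hρ : IsSublinearOperator ρ) {ξ η : BddMeas Ω}
    (hη : IsMinMeanSquareEstimator C ρ ξ η) (t : ℝ) :
    ρ ((ξ - η) ^ 2) ≤ ρ ((ξ - η) ^ 2 + t • (ξ - η)) := by
  set Z := ξ - η with hZ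
  -- Moving `η` by a constant changes the squared error by a multiple of `Z`, up to second order.
  have hquad : ∀ s : ℝ, ρ (Z ^ 2) ≤ ρ (Z ^ 2 + s • Z) + s ^ 2 / 4 := by
    intro s
    have h1 := hη.2 (η - algebraMap ℝ _ (s / 2))
      (Measurable.sub hη.1 (@measurable_const _ _ _ C (s / 2)))
    refine h1.trans ?_
    rw [← hρ.const (s ^ 2 / 4)]
    refine le_of_eq_of_le (congrArg ρ ?_) (hρ.subadd _ _)
    ext ω
    change (ξ.1 ω - (η.1 ω - s / 2)) ^ 2
      = (ξ.1 ω - η.1 ω) ^ 2 + s * (ξ.1 ω - η.1 ω) + s ^ 2 / 4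
    ring
  refine le_of_forall_pos_le_add fun ε hε => ?_
  -- Convexity along the line removes the second order term.
  have hpos : 0 < ε + t ^ 2 := by positivity
  set r := ε / (ε + t ^ 2) with hr
  have hr0 : 0 < r := div_pos hε hpos
  have hr1 : r ≤ 1 := (div_le_one hpos).2 (by nlinarith [sq_nonneg t])
  have hrt : r * t ^ 2 ≤ ε := by
    rw [hr, div_mul_eq_mul_div, div_le_iff₀ hpos]
    nlinarith [sq_nonneg t]
  have h1 := hquad (r * t)
  have h2 : ρ (Z ^ 2 + (r * t) • Z) ≤ (1 - r) * ρ (Z ^ 2) + r * ρ (Z ^ 2 + t • Z) := by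
    rw [← hρ.posHom _ _ (sub_nonneg.2 hr1), ← hρ.posHom _ _ hr0.le]
    refine le_of_eq_of_le (congrArg ρ ?_) (hρ.subadd _ _)
    module
  have h3 : r * ρ (Z ^ 2) ≤ r * (ρ (Z ^ 2 + t • Z) + ε) := by nlinarith
  exact le_of_mul_le_mul_left h3 hr0

theorem map_const_of_mem_dominated (hρ : IsSublinearOperator ρ) {E : BddMeas Ω →ₗ[ℝ] ℝ}
    (hE : E ∈ dominated ρ) (c : ℝ) : E (algebraMap ℝ (BddMeas Ω) c) = c := by
  have h1 := hE (algebraMap ℝ (BddMeas Ω) c)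
  have h2 := hE (algebraMap ℝ (BddMeas Ω) (-c))
  rw [hρ.const] at h1 h2
  rw [map_neg, map_neg] at h2
  linarith

/-- The constant `c` that is optimal among all constants is optimal among all bounded
`C`-measurable functions: first-order optimality yields a functional `E` below `ρ` that attains
`ρ` at `(ξ - c) ^ 2` and has `E (ξ - c) = 0`, and under `E` independence makes `c` the best
estimator. -/
theorem exists_const_isMinMeanSquareEstimator (hρ : IsSublinearOperator ρ)
    (hcont : IsContinuousFromAbove ρ) (P₀ : Measure Ω) [IsProbabilityMeasure P₀]
    (hproper : IsProper ρ P₀) (hC : C ≤ mΩ) (ξ : BddMeas Ω)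
    (hind : ∀ E ∈ dominated ρ, IsIndepOf C E ξ) :
    ∃ c : ℝ, IsMinMeanSquareEstimator C ρ ξ (algebraMap ℝ (BddMeas Ω) c) := by
  obtain ⟨η₀, hη₀⟩ := exists_isMinMeanSquareEstimator hρ hcont P₀ hproper bot_le ξ
  obtain ⟨c, hc⟩ := eq_const_of_measurable_bot hη₀.1
  obtain rfl : η₀ = algebraMap ℝ (BddMeas Ω) c := Subtype.ext hc
  refine ⟨c, @measurable_const _ _ _ C c, fun η hη => ?_⟩
  set κ := algebraMap ℝ (BddMeas Ω) c with hκ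
  obtain ⟨E, hE, hEsq, hE0⟩ := exists_linear_le_sublinear_of_forall_le ρ
    (fun a ha x => hρ.posHom a x ha.le) hρ.subadd ((ξ - κ) ^ 2) (ξ - κ)
    (hη₀.le_map_add_smul hρ)
  have hEd : E ∈ dominated ρ := hE
  have hW : Measurable[C] (η - κ).1 := Measurable.sub hη (@measurable_const _ _ _ C c)
  have hprod := (hind E hEd).map_mul hρ hC hEd hW
  have hEκ : E κ = c := map_const_of_mem_dominated hρ hEd c
  have hκW : E (κ * (η - κ)) = c * E (η - κ) := by
    rw [hκ, ← Algebra.smul_def, map_smul, smul_eq_mul]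
  have hEξ : E ξ = c := by
    rw [map_sub, hEκ] at hE0
    linarith
  have hexp : (ξ - η) ^ 2
      = (ξ - κ) ^ 2 - (2 : ℝ) • (ξ * (η - κ) - κ * (η - κ)) + (η - κ) ^ 2 := by
    rw [two_smul]
    ring
  have hnonneg : 0 ≤ E ((η - κ) ^ 2) :=
    map_nonneg_of_mem_dominated hρ hEd fun ω => sq_nonneg (η.1 ω - κ.1 ω)
  have hEexp : E ((ξ - η) ^ 2) = E ((ξ - κ) ^ 2) + E ((η - κ) ^ 2) := by
    rw [hexp, map_add, map_sub, map_smul, map_sub, hprod, hκW, hEξ, sub_self, smul_zero, sub_zero]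
  have := hE ((ξ - η) ^ 2)
  linarith

end Estimator

/-! ### Properties of the minimum mean square estimator -/

theorem proposition5p1 {Ω : Type*} (C : MeasurableSpace Ω) [mΩ : MeasurableSpace Ω]
    (ρ : BddMeas Ω → ℝ) (hρ : IsSublinearOperator ρ) (hcont : IsContinuousFromAbove ρ)
    (P₀ : Measure Ω) [IsProbabilityMeasure P₀] (hproper : IsProper ρ P₀)
    (hC : C ≤ mΩ) (ξ : BddMeas Ω) :
    -- the estimator `ρ(ξ | C)` exists and is unique up to `P₀`-null sets
    (∃ η : BddMeas Ω, IsMinMeanSquareEstimator C ρ ξ η) ∧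
    (∀ η η' : BddMeas Ω, IsMinMeanSquareEstimator C ρ ξ η →
      IsMinMeanSquareEstimator C ρ ξ η' → η.1 =ᵐ[P₀] η'.1) ∧
    -- i)
    (∀ C₁ C₂ : ℝ, (∀ ω, C₁ ≤ ξ.1 ω ∧ ξ.1 ω ≤ C₂) →
      ∀ η : BddMeas Ω, IsMinMeanSquareEstimator C ρ ξ η →
        ∀ᵐ ω ∂P₀, C₁ ≤ η.1 ω ∧ η.1 ω ≤ C₂) ∧
    -- ii)
    (∀ (l : ℝ) (η η' : BddMeas Ω), IsMinMeanSquareEstimator C ρ ξ η →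
      IsMinMeanSquareEstimator C ρ (l • ξ) η' → ∀ᵐ ω ∂P₀, η'.1 ω = l * η.1 ω) ∧
    -- iii)
    (∀ η₀ : BddMeas Ω, Measurable[C] η₀.1 →
      ∀ η η' : BddMeas Ω, IsMinMeanSquareEstimator C ρ ξ η →
        IsMinMeanSquareEstimator C ρ (ξ + η₀) η' → ∀ᵐ ω ∂P₀, η'.1 ω = η.1 ω + η₀.1 ω) ∧
    -- iv)
    ((∀ E ∈ dominated ρ, IsIndepOf C E ξ) →
      ∀ η : BddMeas Ω, IsMinMeanSquareEstimator C ρ ξ η →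
        ∃ c : ℝ, ∀ᵐ ω ∂P₀, η.1 ω = c) := by
  refine ⟨exists_isMinMeanSquareEstimator hρ hcont P₀ hproper hC ξ,
    fun η η' hη hη' => hη.ae_eq hρ hproper hη', fun a b hab η hη => ?_,
    fun l η η' hη hη' => hη'.ae_eq hρ hproper (hη.smul hρ l),
    fun η₀ hη₀ η η' hη hη' => hη'.ae_eq hρ hproper (hη.add hη₀), fun hind η hη => ?_⟩
  · filter_upwards [hη.ae_eq hρ hproper (hη.clip hρ hab)] with ω hω
    rw [hω]
    exact ⟨le_max_left _ _, max_le ((hab ω).1.trans (hab ω).2) (min_le_left _ _)⟩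
  · obtain ⟨c, hc⟩ := exists_const_isMinMeanSquareEstimator hρ hcont P₀ hproper hC ξ hind
    exact ⟨c, hη.ae_eq hρ hproper hc⟩
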